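/- Let $d\ge 1$, let $\Omega\subseteq\mathbb R^d$ be open and convex, let $q\in\mathbb N_{\ge 0}$, and let $k:\Omega\times\Omega\to\mathbb R$ be $q+1$ asymptotically smooth: for all multi-indices with $|\alpha|,|\beta|\le q+1$ the partial derivatives $\partial_x^\alpha\partial_y^\beta k$ exist and are continuous on $\{(x,y)\in\Omega\times\Omega: x\ne y\}$, and there are constants $c,r>0$ with $|\partial_x^\alpha\partial_y^\beta k(x,y)|\le c\,|\alpha+\beta|!\,(r\|x-y\|_2)^{-|\alpha+\beta|}$ there. For points $X_N=\{x_1,\dots,x_N\}\subset\Omega$, $N\ge 2$, let $q_{X_N}=\frac12\min_{i\ne j}\|x_i-x_j\|_2$. Let $m_q=\binom{q+d}{d}$, and let $B_v$ denote the bounding box of a cluster $v\subseteq X_N$, that is, the smallest axis-parallel box containing $v$. *Cluster tree.* Let $\mathcal T$ be a binary cluster tree with root $X_N$ in which every leaf is nonempty and has at most $m_q$ points, and every other cluster $v$ is the disjoint union of its two nonempty sons, which are obtained by cutting $B_v$ perpendicularly to a longest edge at some value (points on the cut may go to either son) in such a way that the cardinalities of the two sons differ by at most two. *Samplet basis.*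 Let $\Sigma_J=\{\sigma_1,\dots,\sigma_N\}$ be a samplet basis of $\mathrm{span}\{\delta_{x_1},\dots,\delta_{x_N}\}$ constructed on $\mathcal T$ as follows, from the leaves to the root. A leaf $v$ has the scaling functions $\delta_x$, $x\in v$, and no samplets. For a non-leaf $v$ let $\Phi=[\varphi_1,\dots,\varphi_n]$ be the row of the scaling functions of its sons, let $M=[(z^\alpha,\varphi_i)]_{|\alpha|\le q,\,1\le i\le n}$ be its moment matrix (rows ordered arbitrarily), where $(f,\sum_i\omega_i\delta_{x_i})=\sum_i\omega_i f(x_i)$, and let $M^T=QR$ be a QR decomposition with $Q\in\mathbb R^{n\times n}$ orthogonal and $R$ upper triangular; the first $\min\{m_q,n\}$ entries of $\Phi Q$ are the scaling functions of $v$ and the remaining ones are the samplets of $v$. The basis $\Sigma_J$ consists of the scaling functions of the root, which belong to the root cluster, and the samplets of all clusters. *Matrices.* Let $K^\Sigma=[(k,\sigma_j\otimes\sigma_{j'})]_{j,j'=1}^N$, where $(k,\sum_i\omega_i\delta_{x_i}\otimes\sum_{i'}\omega'_{i'}\delta_{x_{i'}})=\sum_{i,i'}\omega_i\omega'_{i'}k(x_i,x_{i'})$.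 For $\eta>0$ let $K^\Sigma_\eta$ be obtained from $K^\Sigma$ by setting to zero every entry whose two basis functions belong to clusters $v,v'$ satisfying the admissibility condition $\mathrm{dist}(B_v,B_{v'})\ge\eta\max\{\mathrm{diam}(B_v),\mathrm{diam}(B_{v'})\}$. Then for all constants $C_1,C_2>0$ there is a constant $C>0$, depending only on $\Omega$, $k$, $q$, $C_1$ and $C_2$ (and in particular not on $N$, the points, the tree, the basis or $\eta$), such that, whenever $N\ge2$, $q_{X_N}\ge C_1N^{-1/d}$ and $\|K^\Sigma\|_F\ge C_2N$, one has for every $\eta>0$ $$\frac{\|K^\Sigma-K^\Sigma_\eta\|_F}{\|K^\Sigma\|_F}\le C\,\eta^{-2(q+1)}\sqrt{\log N}.$$ -/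

import Mathlib

open scoped Matrix.Norms.Frobenius

namespace Samplet

/-! ## Points, bounding boxes, clusters -/

/-- The separation radius `q_X = ½ min_{i ≠ j} ‖x_i - x_j‖₂` of the points `x_1, …, x_N`. -/
noncomputable def separationRadius {d N : ℕ} (x : Fin N → EuclideanSpace ℝ (Fin d)) : ℝ :=
  sInf {ρ : ℝ | ∃ i j : Fin N, i ≠ j ∧ ρ = dist (x i) (x j) / 2}

/-- Smallest `ℓ`-th coordinate of the points of the cluster `v`.
A cluster is given by the set of the indices of its points. -/
noncomputable def boxMin {d N : ℕ} (x : Fin N → EuclideanSpace ℝ (Fin d)) (v : Finset (Fin N))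
    (l : Fin d) : ℝ :=
  sInf ((fun i : Fin N => x i l) '' (v : Set (Fin N)))

/-- Largest `ℓ`-th coordinate of the points of the cluster `v`. -/
noncomputable def boxMax {d N : ℕ} (x : Fin N → EuclideanSpace ℝ (Fin d)) (v : Finset (Fin N))
    (l : Fin d) : ℝ :=
  sSup ((fun i : Fin N => x i l) '' (v : Set (Fin N)))

/-- The bounding box `B_v`: the smallest axis-parallel box that contains the points of `v`. -/
def boundingBox {d N : ℕ} (x : Fin N → EuclideanSpace ℝ (Fin d)) (v : Finset (Fin N)) :
    Set (EuclideanSpace ℝ (Fin d)) :=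
  {z | ∀ l : Fin d, boxMin x v l ≤ z l ∧ z l ≤ boxMax x v l}

/-- Length `L_ℓ` of the edge of `B_v` along the dimension `ℓ`. -/
noncomputable def edgeLength {d N : ℕ} (x : Fin N → EuclideanSpace ℝ (Fin d))
    (v : Finset (Fin N)) (l : Fin d) : ℝ :=
  boxMax x v l - boxMin x v l

/-- The distance `inf {‖a - b‖₂ : a ∈ A, b ∈ B}` of two sets. -/
noncomputable def setDist {d : ℕ} (A B : Set (EuclideanSpace ℝ (Fin d))) : ℝ :=
  sInf {ρ : ℝ | ∃ a ∈ A, ∃ b ∈ B, ρ = dist a b}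

/-- The admissibility condition
`dist (B_v, B_v') ≥ η max {diam B_v, diam B_v'}` for a pair of clusters. -/
def Admissible {d N : ℕ} (x : Fin N → EuclideanSpace ℝ (Fin d)) (η : ℝ)
    (v v' : Finset (Fin N)) : Prop :=
  η * max (Metric.diam (boundingBox x v)) (Metric.diam (boundingBox x v')) ≤
    setDist (boundingBox x v) (boundingBox x v')

/-! ## Balanced binary cluster trees -/

/-- Finite binary trees, every node of which carries a cluster. -/
inductive ClusterTree (N : ℕ) : Type
  | leaf (v : Finset (Fin N)) : ClusterTree N
  | node (v : Finset (Fin N)) (t₁ t₂ : ClusterTree N) : ClusterTree N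

/-- The cluster at the root of a tree. -/
def ClusterTree.cluster {N : ℕ} : ClusterTree N → Finset (Fin N)
  | .leaf v => v
  | .node v _ _ => v

/-- The splitting rule: the cluster `v` is the disjoint union of its sons `v₁`, `v₂`; the
bounding box of `v` is cut at a value `m` along (one of) its longest edge(s), points with
coordinate `m` may go to either son, and the sons have nearly the same number of points. The
tolerance `2` covers the median split also when many points share the median coordinate. -/
def IsBisection {d N : ℕ} (x : Fin N → EuclideanSpace ℝ (Fin d))
    (v v₁ v₂ : Finset (Fin N)) : Prop :=
  v₁.Nonempty ∧ v₂.Nonempty ∧ Disjoint v₁ v₂ ∧ v₁ ∪ v₂ = v ∧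
  v₁.card ≤ v₂.card + 2 ∧ v₂.card ≤ v₁.card + 2 ∧
  ∃ l : Fin d, (∀ l' : Fin d, edgeLength x v l' ≤ edgeLength x v l) ∧
    ∃ m : ℝ, (∀ i ∈ v₁, m ≤ x i l) ∧ (∀ i ∈ v₂, x i l ≤ m)

/-- All splits of the tree follow the splitting rule, and each leaf is a nonempty cluster of
at most `m` points. -/
inductive IsBisectionTree {d N : ℕ} (x : Fin N → EuclideanSpace ℝ (Fin d)) (m : ℕ) :
    ClusterTree N → Prop
  | leaf (v : Finset (Fin N)) (hne : v.Nonempty) (hcard : v.card ≤ m) :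
      IsBisectionTree x m (.leaf v)
  | node (v : Finset (Fin N)) (t₁ t₂ : ClusterTree N)
      (hsplit : IsBisection x v t₁.cluster t₂.cluster)
      (h₁ : IsBisectionTree x m t₁) (h₂ : IsBisectionTree x m t₂) :
      IsBisectionTree x m (.node v t₁ t₂)

/-! ## The samplet basis

An element `∑ ω_i δ_{x_i}` of `V = span {δ_{x_1}, …, δ_{x_N}}` is given by its coefficient
vector `ω : Fin N → ℝ`. -/

/-- The multi-indices `α ∈ ℕ^d` with `|α| ≤ q`. -/
abbrev MultiIndex (d q : ℕ) : Type := {α : Fin d → ℕ // ∑ l, α l ≤ q}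

/-- The number `m_q` of monomials in `d` variables of total degree at most `q`. -/
def numMonomials (d q : ℕ) : ℕ := (q + d).choose d

/-- There are exactly `m_q` multi-indices, so that the rows of the moment matrices below can
indeed be numbered by `Fin m_q`. -/
theorem card_multiIndex (d q : ℕ) : Nat.card (MultiIndex d q) = numMonomials d q := by
  have e : MultiIndex d q ≃ {P : Fin (d + 1) → ℕ // ∑ i, P i = q} :=
    { toFun := fun α => ⟨Fin.cons (q - ∑ l, α.1 l) α.1, by
        rw [Fin.sum_univ_succ]
        simp only [Fin.cons_zero, Fin.cons_succ]
        have := α.2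
        omega⟩
      invFun := fun P => ⟨Fin.tail P.1, by
        have := P.2
        rw [Fin.sum_univ_succ] at this
        simp only [Fin.tail]
        omega⟩
      left_inv := fun α => by
        ext l
        simp
      right_inv := fun P => by
        have h := P.2
        rw [Fin.sum_univ_succ] at h
        ext i
        refine Fin.cases ?_ (fun j => ?_) i
        · simp only [Fin.cons_zero, Fin.tail]
          omega
        · simp [Fin.tail] }
  rw [Nat.card_congr (e.trans (Sym.equivNatSumOfFintype (Fin (d + 1)) q).symm),
    Nat.card_eq_fintype_card, Sym.card_sym_eq_choose, Fintype.card_fin, numMonomials]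
  rw [show d + 1 + q - 1 = q + d by omega]
  exact Nat.choose_symm_add

/-- The pairing `(f, φ)_Ω = ∑ ω_i f(x_i)` of the monomial `f = z^α` with the element `φ` of `V`
with coefficient vector `ω`. -/
noncomputable def moment {d N : ℕ} (x : Fin N → EuclideanSpace ℝ (Fin d)) (α : Fin d → ℕ)
    (ω : Fin N → ℝ) : ℝ :=
  ∑ i, ω i * ∏ l, x i l ^ α l

/-- The row `Ψ` of functions is `Φ Q`, where `Mᵀ = Q R` is a QR decomposition (`Q` orthogonal,
`R` upper triangular) of the transpose of the moment matrix `M` of the row `Φ`, whose rows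
are ordered by `e`. -/
def IsQRTransform {d N : ℕ} (x : Fin N → EuclideanSpace ℝ (Fin d)) (q : ℕ)
    (Φ Ψ : List (Fin N → ℝ)) : Prop :=
  ∃ (e : Fin (numMonomials d q) ≃ MultiIndex d q)
    (Q : Matrix (Fin Φ.length) (Fin Φ.length) ℝ)
    (R : Matrix (Fin Φ.length) (Fin (numMonomials d q)) ℝ),
    Q ∈ Matrix.orthogonalGroup (Fin Φ.length) ℝ ∧
    (∀ (a : Fin Φ.length) (b : Fin (numMonomials d q)), (b : ℕ) < (a : ℕ) → R a b = 0) ∧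
    (Matrix.of fun (b : Fin (numMonomials d q)) (a : Fin Φ.length) =>
      moment x (e b).1 (Φ.get a)).transpose = Q * R ∧
    Ψ = List.ofFn fun c : Fin Φ.length => ∑ a : Fin Φ.length, Q a c • Φ.get a

/-- `IsSampletConstruction x q t Φ S`: the recursive construction on the cluster tree `t` can
produce the scaling functions `Φ` at the root of `t` and the samplets `S` of all clusters of
`t`, each samplet being listed together with the cluster that provides it. A leaf provides the
point evaluations at its points as scaling functions and no samplets; at an inner node the
scaling functions of the two sons are transformed, the first `m_q` of the resulting functions
(all, if there are fewer) are its scaling functions, the remaining ones its samplets. -/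
inductive IsSampletConstruction {d N : ℕ} (x : Fin N → EuclideanSpace ℝ (Fin d)) (q : ℕ) :
    ClusterTree N → List (Fin N → ℝ) → List (Finset (Fin N) × (Fin N → ℝ)) → Prop
  | leaf (v : Finset (Fin N)) (L : List (Fin N)) (hL : L.Nodup) (hv : L.toFinset = v) :
      IsSampletConstruction x q (.leaf v) (L.map fun i => Pi.single i 1) []
  | node (v : Finset (Fin N)) (t₁ t₂ : ClusterTree N) (Φ₁ Φ₂ Ψ : List (Fin N → ℝ))
      (S₁ S₂ : List (Finset (Fin N) × (Fin N → ℝ)))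
      (h₁ : IsSampletConstruction x q t₁ Φ₁ S₁) (h₂ : IsSampletConstruction x q t₂ Φ₂ S₂)
      (hΨ : IsQRTransform x q (Φ₁ ++ Φ₂) Ψ) :
      IsSampletConstruction x q (.node v t₁ t₂) (Ψ.take (numMonomials d q))
        ((Ψ.drop (numMonomials d q)).map (fun σ => (v, σ)) ++ S₁ ++ S₂)

/-- `b` lists a samplet basis of `V` constructed on the tree `t`: the scaling functions of the
root cluster followed by the samplets of all clusters. The first component of an entry is the
cluster it belongs to, the second one its coefficient vector. -/
def IsSampletBasis {d N : ℕ} (x : Fin N → EuclideanSpace ℝ (Fin d)) (q : ℕ)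
    (t : ClusterTree N) (b : List (Finset (Fin N) × (Fin N → ℝ))) : Prop :=
  ∃ (Φ : List (Fin N → ℝ)) (S : List (Finset (Fin N) × (Fin N → ℝ))),
    IsSampletConstruction x q t Φ S ∧ b = Φ.map (fun φ => (t.cluster, φ)) ++ S

/-! ## Kernels and the compressed kernel matrix -/

/-- `D α β = ∂^{|α + β|} k / ∂x^α ∂y^β` for all `|α|, |β| ≤ s`, off the diagonal of `Ω × Ω`:
these partial derivatives of `k` exist there and are continuous. -/
structure IsMixedPartials {d : ℕ} (Ω : Set (EuclideanSpace ℝ (Fin d))) (s : ℕ)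
    (k : EuclideanSpace ℝ (Fin d) → EuclideanSpace ℝ (Fin d) → ℝ)
    (D : (Fin d → ℕ) → (Fin d → ℕ) →
      EuclideanSpace ℝ (Fin d) → EuclideanSpace ℝ (Fin d) → ℝ) : Prop where
  zero : ∀ x ∈ Ω, ∀ y ∈ Ω, x ≠ y → D 0 0 x y = k x y
  continuousOn : ∀ α β : Fin d → ℕ, ∑ l, α l ≤ s → ∑ l, β l ≤ s →
    ContinuousOn
      (fun z : EuclideanSpace ℝ (Fin d) × EuclideanSpace ℝ (Fin d) => D α β z.1 z.2)
      {z | z.1 ∈ Ω ∧ z.2 ∈ Ω ∧ z.1 ≠ z.2}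
  deriv_left : ∀ (α β : Fin d → ℕ) (l : Fin d), ∑ l, α l < s → ∑ l, β l ≤ s →
    ∀ x ∈ Ω, ∀ y ∈ Ω, x ≠ y →
      HasLineDerivAt ℝ (fun z => D α β z y) (D (α + Pi.single l 1) β x y) x
        (EuclideanSpace.single l 1)
  deriv_right : ∀ (α β : Fin d → ℕ) (l : Fin d), ∑ l, α l ≤ s → ∑ l, β l < s →
    ∀ x ∈ Ω, ∀ y ∈ Ω, x ≠ y →
      HasLineDerivAt ℝ (fun z => D α β x z) (D α (β + Pi.single l 1) x y) y
        (EuclideanSpace.single l 1)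

/-- The kernel `k` is `s` asymptotically smooth on `Ω`. Only the values of `k` on `Ω × Ω`
matter. -/
def IsAsymptoticallySmooth {d : ℕ} (Ω : Set (EuclideanSpace ℝ (Fin d))) (s : ℕ)
    (k : EuclideanSpace ℝ (Fin d) → EuclideanSpace ℝ (Fin d) → ℝ) : Prop :=
  ∃ D, IsMixedPartials Ω s k D ∧ ∃ C r : ℝ, 0 < C ∧ 0 < r ∧
    ∀ α β : Fin d → ℕ, ∑ l, α l ≤ s → ∑ l, β l ≤ s →
      ∀ x ∈ Ω, ∀ y ∈ Ω, x ≠ y →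
        |D α β x y| ≤
          C * ((∑ l, (α l + β l)).factorial : ℝ) / (r * ‖x - y‖) ^ (∑ l, (α l + β l))

/-- `(k, φ ⊗ φ')_{Ω × Ω}` for elements `φ`, `φ'` of `V` with coefficient vectors `ω`, `ω'`. -/
noncomputable def kernelPairing {d N : ℕ} (x : Fin N → EuclideanSpace ℝ (Fin d))
    (k : EuclideanSpace ℝ (Fin d) → EuclideanSpace ℝ (Fin d) → ℝ) (ω ω' : Fin N → ℝ) : ℝ :=
  ∑ i, ∑ i', ω i * ω' i' * k (x i) (x i')

/-- The kernel matrix `K^Σ = [(k, σ_j ⊗ σ_j')]` in samplet representation. -/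
noncomputable def sampletMatrix {d N : ℕ} (x : Fin N → EuclideanSpace ℝ (Fin d))
    (k : EuclideanSpace ℝ (Fin d) → EuclideanSpace ℝ (Fin d) → ℝ)
    (b : List (Finset (Fin N) × (Fin N → ℝ))) : Matrix (Fin b.length) (Fin b.length) ℝ :=
  Matrix.of fun j j' => kernelPairing x k (b.get j).2 (b.get j').2

open Classical in
/-- The compressed matrix `K^Σ_η`: the entries that belong to an admissible pair of clusters
are set to zero. -/
noncomputable def compressedMatrix {d N : ℕ} (x : Fin N → EuclideanSpace ℝ (Fin d))
    (k : EuclideanSpace ℝ (Fin d) → EuclideanSpace ℝ (Fin d) → ℝ)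
    (b : List (Finset (Fin N) × (Fin N → ℝ))) (η : ℝ) :
    Matrix (Fin b.length) (Fin b.length) ℝ :=
  Matrix.of fun j j' =>
    if Admissible x η (b.get j).1 (b.get j').1 then 0 else sampletMatrix x k b j j'

end Samplet

open scoped Matrix.Norms.Frobenius

namespace Samplet

/-! The scaling functions at the root are never compressed, because the root box meets every other
box. Only pairs of samplets on admissible clusters v, v' contribute to the error. Write L, L' for
the longest edges. Vanishing moments in both variables bound such an entry by a constant times ‖ω‖₁
‖ω'‖₁ (L L' / δ²)^(q+1), where δ is any positive lower bound for the distance of the boxes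
(`abs_kernelPairing_le`). Admissibility allows δ = η max(L, L'), and ‖ω‖₁² ≤ |v| by Cauchy–Schwarz.
The squared entry is therefore at most a constant times η^(-4(q+1)) |v| |v'| min(L, L') / max(L,
L').

What remains is to sum these bounds over the tree, which yields at most m_q samplets per cluster.
For fixed v with D = L, the sum over v' is O(N): the potential |w| ∑ₗ Eₗ / (D + Eₗ), with Eₗ the
edges of w, drops at each bisection by at least a multiple of the summand
(`IsBisectionTree.innerSum_scale_le`). The sum of |v| over all inner clusters is O(N log N), since
the entropy n log n pays for each nearly balanced split (`IsBisectionTree.innerSum_card_le`). The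
squared error is thus O(η^(-4(q+1)) N² log N), to be divided by (C₂ N)². -/

/-! ### From continuous partial derivatives to differentiability -/

/-- A function whose partial derivatives exist near a point and are continuous there is
differentiable at the point. -/
theorem hasFDerivAt_of_lineDeriv_continuousAt {d : ℕ} {U : Set (EuclideanSpace ℝ (Fin d))}
    (hU : IsOpen U) {f : EuclideanSpace ℝ (Fin d) → ℝ}
    {g : Fin d → EuclideanSpace ℝ (Fin d) → ℝ}
    (hf : ∀ l, ∀ z ∈ U, HasLineDerivAt ℝ f (g l z) z (EuclideanSpace.single l 1))
    {x : EuclideanSpace ℝ (Fin d)} (hx : x ∈ U) (hg : ∀ l, ContinuousAt (g l) x) :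
    HasFDerivAt f (∑ l, g l x • (EuclideanSpace.proj l : EuclideanSpace ℝ (Fin d) →L[ℝ] ℝ)) x := by
  rw [hasFDerivAt_iff_isLittleO_nhds_zero, Asymptotics.isLittleO_iff]
  intro c hc
  obtain ⟨ε, hε, hεc⟩ : ∃ ε : ℝ, 0 < ε ∧ (d : ℝ) * ε ≤ c :=
    ⟨c / (d + 1), by positivity, by
      rw [mul_div_assoc', div_le_iff₀ (by positivity)]; nlinarith⟩
  have hev : ∀ᶠ z in nhds x, z ∈ U ∧ ∀ l, |g l z - g l x| < ε := by
    refine Filter.Eventually.and (hU.mem_nhds hx) (Filter.eventually_all.2 fun l => ?_)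
    simpa [Real.dist_eq] using Metric.tendsto_nhds.1 (hg l) ε hε
  obtain ⟨δ, hδ, hball⟩ := Metric.eventually_nhds_iff.1 hev
  have hsmall : ∀ᶠ h : EuclideanSpace ℝ (Fin d) in nhds 0, ‖h‖ < δ := by
    refine Metric.eventually_nhds_iff.2 ⟨δ, hδ, fun h hh => by simpa using hh⟩
  filter_upwards [hsmall] with h hh
  -- The increment h restricted to the coordinates in s. Adding the coordinates one at a time never
  -- leaves the ball of radius ‖h‖ about x, so the partial derivatives stay ε-close to their values
  -- at x.
  let p : Finset (Fin d) → EuclideanSpace ℝ (Fin d) :=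
    fun s => ∑ l ∈ s, EuclideanSpace.single l (h l)
  have hp : ∀ s m, p s m = if m ∈ s then h m else 0 := by
    intro s m
    simp [p, Pi.single_apply]
  have hnear : ∀ s l, l ∉ s → ∀ t ∈ Set.Icc (0 : ℝ) 1,
      dist (x + p s + t • EuclideanSpace.single l (h l)) x < δ := by
    intro s l hl t ht
    rw [dist_eq_norm]
    refine lt_of_le_of_lt ?_ hh
    rw [EuclideanSpace.norm_eq, EuclideanSpace.norm_eq]
    refine Real.sqrt_le_sqrt (Finset.sum_le_sum fun m _ => ?_)
    have e : (x + p s + t • EuclideanSpace.single l (h l) - x) m =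
        (if m ∈ s then h m else 0) + t * (if m = l then h l else 0) := by
      simp [hp]
      ring
    rw [e, Real.norm_eq_abs, Real.norm_eq_abs, sq_abs, sq_abs]
    by_cases hm : m = l
    · subst hm
      simp only [hl, if_false, if_true, zero_add, mul_pow]
      have := pow_le_one₀ ht.1 ht.2 (n := 2)
      nlinarith [sq_nonneg (h m)]
    · by_cases hms : m ∈ s <;> simp [hm, hms, sq_nonneg]
  have key : ∀ s : Finset (Fin d),
      |f (x + p s) - f x - ∑ l ∈ s, g l x * h l| ≤ ∑ l ∈ s, ε * |h l| := by
    intro s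
    induction s using Finset.induction_on with
    | empty => simp [p]
    | insert l s hl ih =>
      have hps : p (insert l s) = p s + EuclideanSpace.single l (h l) := by
        simp only [p, Finset.sum_insert hl, add_comm]
      -- Mean value inequality along one coordinate, with the linear term frozen at x already
      -- subtracted.
      have hmv := norm_image_sub_le_of_norm_deriv_le_segment_01'
        (f := fun t : ℝ => f (x + p s + t • EuclideanSpace.single l (h l)) - t * (g l x * h l))
        (f' := fun t : ℝ => g l (x + p s + t • EuclideanSpace.single l (h l)) * h l - g l x * h l)
        (C := ε * |h l|)
        (fun t ht => by
          have h1 := hf l _ (hball (hnear s l hl t ht)).1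
          have h0 : HasDerivAt (fun u : ℝ => (u - t) * h l) (h l) t := by
            simpa using ((hasDerivAt_id t).sub_const t).mul_const (h l)
          unfold HasLineDerivAt at h1
          have h2 := HasDerivAt.scomp_of_eq t h1 h0 (by simp)
          have h3 : HasDerivAt (fun u : ℝ => f (x + p s + u • EuclideanSpace.single l (h l)))
              (g l (x + p s + t • EuclideanSpace.single l (h l)) * h l) t := by
            have e : (fun u : ℝ => f (x + p s + u • EuclideanSpace.single l (h l))) =
                (fun u : ℝ => f (x + p s + t • EuclideanSpace.single l (h l) +
                  u • EuclideanSpace.single l 1)) ∘ fun u => (u - t) * h l := by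
              funext u
              simp only [Function.comp]
              congr 1
              rw [add_assoc (x + p s)]
              congr 1
              ext m
              by_cases hm : m = l
              · subst hm
                simp
                ring
              · simp [hm]
            rw [e, mul_comm]
            exact h2
          have h4 := (h3.sub ((hasDerivAt_id t).mul_const (g l x * h l))).hasDerivWithinAt
            (s := Set.Icc (0 : ℝ) 1)
          rw [one_mul] at h4
          exact h4)
        (fun t ht => by
          rw [← sub_mul, Real.norm_eq_abs, abs_mul]
          exact mul_le_mul_of_nonneg_right
            ((hball (hnear s l hl t ⟨ht.1, ht.2.le⟩)).2 l).le (abs_nonneg _))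
      rw [Finset.sum_insert hl, Finset.sum_insert hl, hps]
      simp only [one_smul, zero_smul, add_zero, one_mul, zero_mul, sub_zero,
        Real.norm_eq_abs] at hmv
      rw [← add_assoc]
      calc _ = |(f (x + p s + EuclideanSpace.single l (h l)) - g l x * h l - f (x + p s)) +
            (f (x + p s) - f x - ∑ l ∈ s, g l x * h l)| := by congr 1; ring
        _ ≤ _ := (abs_add_le _ _).trans (add_le_add hmv ih)
  have hpu : p Finset.univ = h := by
    ext m
    simp [hp]
  have := key Finset.univ
  rw [hpu] at this
  rw [Real.norm_eq_abs]
  simp only [FunLike.coe_sum, Finset.sum_apply, FunLike.coe_smul,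
    Pi.smul_apply, PiLp.proj_apply, smul_eq_mul]
  refine this.trans ?_
  calc ∑ l, ε * |h l| ≤ ∑ _l : Fin d, ε * ‖h‖ := by
        refine Finset.sum_le_sum fun l _ => mul_le_mul_of_nonneg_left ?_ hε.le
        simpa using PiLp.norm_apply_le h l
    _ = d * ε * ‖h‖ := by simp; ring
    _ ≤ c * ‖h‖ := by gcongr

/-! ### Functionals that annihilate polynomials -/

/-- The discrete functional with the nodes `y` and the weights `ω` annihilates all polynomials of
total degree less than `n`. -/
def AnnihilatesPolynomials {ι : Type*} {d : ℕ} (s : Finset ι) (y : ι → EuclideanSpace ℝ (Fin d))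
    (ω : ι → ℝ) (n : ℕ) : Prop :=
  ∀ P : MvPolynomial (Fin d) ℝ, P.totalDegree < n → ∑ i ∈ s, ω i * P.eval (fun l => y i l) = 0

theorem annihilatesPolynomials_of_moment {d N : ℕ} {x : Fin N → EuclideanSpace ℝ (Fin d)}
    {ω : Fin N → ℝ} {q : ℕ} {v : Finset (Fin N)} (hv : ∀ i ∉ v, ω i = 0)
    (h : ∀ α : Fin d → ℕ, ∑ l, α l ≤ q → moment x α ω = 0) :
    AnnihilatesPolynomials v x ω (q + 1) := by
  intro P hP
  rw [Finset.sum_subset (Finset.subset_univ v) (fun i _ hi => by simp [hv i hi])]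
  simp_rw [MvPolynomial.eval_eq', Finset.mul_sum]
  rw [Finset.sum_comm]
  refine Finset.sum_eq_zero fun m hm => ?_
  have hm' : ∑ l, m l ≤ q := by
    have := (MvPolynomial.le_totalDegree hm).trans (Nat.lt_succ_iff.1 hP)
    rwa [Finsupp.sum_fintype _ _ (fun _ => rfl)] at this
  have := h m hm'
  rw [moment] at this
  calc _ = P.coeff m * ∑ i, ω i * ∏ l, x i l ^ m l := by
        rw [Finset.mul_sum]
        exact Finset.sum_congr rfl fun i _ => by ring
    _ = 0 := by rw [this, mul_zero]

theorem totalDegree_bind_le {d : ℕ} (P : MvPolynomial (Fin d) ℝ)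
    (Q : Fin d → MvPolynomial (Fin d) ℝ) (hQ : ∀ l, (Q l).totalDegree ≤ 1) :
    (MvPolynomial.bind₁ Q P).totalDegree ≤ P.totalDegree := by
  rw [MvPolynomial.bind₁, MvPolynomial.aeval_def, MvPolynomial.eval₂_eq']
  refine MvPolynomial.totalDegree_finsetSum_le fun m hm => ?_
  refine (MvPolynomial.totalDegree_mul _ _).trans ?_
  rw [MvPolynomial.algebraMap_eq, MvPolynomial.totalDegree_C, zero_add]
  refine (MvPolynomial.totalDegree_finsetProd _ _).trans ?_
  refine le_trans ?_ (MvPolynomial.le_totalDegree hm)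
  rw [Finsupp.sum_fintype _ _ (fun _ => rfl)]
  refine Finset.sum_le_sum fun l _ => (MvPolynomial.totalDegree_pow _ _).trans ?_
  nlinarith [hQ l]

/-- Contracting the nodes towards `a` and multiplying the weights by a linear factor costs one
order of annihilation. -/
theorem AnnihilatesPolynomials.contract {ι : Type*} {d : ℕ} {s : Finset ι}
    {y : ι → EuclideanSpace ℝ (Fin d)} {ω : ι → ℝ} {n : ℕ}
    (h : AnnihilatesPolynomials s y ω (n + 1)) (a : EuclideanSpace ℝ (Fin d)) (t : ℝ)
    (l : Fin d) :
    AnnihilatesPolynomials s (fun i => a + t • (y i - a)) (fun i => ω i * (y i l - a l)) n := by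
  intro P hP
  let Q : Fin d → MvPolynomial (Fin d) ℝ := fun m =>
    MvPolynomial.C (a m - t * a m) + MvPolynomial.C t * MvPolynomial.X m
  have hQ : ∀ m, (Q m).totalDegree ≤ 1 := fun m => by
    refine (MvPolynomial.totalDegree_add _ _).trans
      (max_le (by rw [MvPolynomial.totalDegree_C]; exact zero_le_one) ?_)
    exact (MvPolynomial.totalDegree_mul _ _).trans (by simp)
  -- The test polynomial is (X_l - a_l) times P composed with the contraction; an affine
  -- substitution does not raise the degree, so the product has degree at most n.
  have := h ((MvPolynomial.X l - MvPolynomial.C (a l)) * MvPolynomial.bind₁ Q P) (by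
    refine lt_of_le_of_lt (MvPolynomial.totalDegree_mul _ _) ?_
    have h1 : (MvPolynomial.X l - MvPolynomial.C (a l) :
        MvPolynomial (Fin d) ℝ).totalDegree ≤ 1 :=
      (MvPolynomial.totalDegree_sub _ _).trans (by simp)
    have h2 := totalDegree_bind_le P Q hQ
    omega)
  rw [← this]
  refine Finset.sum_congr rfl fun i _ => ?_
  have hb : MvPolynomial.eval (fun l => y i l) (MvPolynomial.bind₁ Q P) =
      MvPolynomial.eval (fun m => MvPolynomial.eval (fun l => y i l) (Q m)) P := by
    simp only [MvPolynomial.eval, MvPolynomial.eval₂Hom_bind₁]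
  rw [map_mul, map_sub, MvPolynomial.eval_X, MvPolynomial.eval_C, mul_assoc, hb]
  congr 4
  ext m
  simp [Q]
  ring

/-- A functional that annihilates polynomials of degree less than `n` is small on functions with
bounded partial derivatives of order `n`, `f α` being the partial derivative of order `α` of
`f 0`. -/
theorem AnnihilatesPolynomials.abs_sum_le {ι : Type*} {d : ℕ} {s : Finset ι}
    {U A : Set (EuclideanSpace ℝ (Fin d))} (hU : IsOpen U) (hA : Convex ℝ A) (hAU : A ⊆ U)
    {L M : ℝ} (hL : 0 ≤ L) (hM : 0 ≤ M) {a : EuclideanSpace ℝ (Fin d)} (ha : a ∈ A) :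
    ∀ {n : ℕ} {f : (Fin d → ℕ) → EuclideanSpace ℝ (Fin d) → ℝ}
    (_ : ∀ α, ∑ l, α l ≤ n → ContinuousOn (f α) U)
    (_ : ∀ α l, ∑ l, α l < n → ∀ z ∈ U,
      HasLineDerivAt ℝ (f α) (f (α + Pi.single l 1) z) z (EuclideanSpace.single l 1))
    (_ : ∀ α, ∑ l, α l = n → ∀ z ∈ A, |f α z| ≤ M)
    {y : ι → EuclideanSpace ℝ (Fin d)} (_ : ∀ i ∈ s, y i ∈ A)
    (_ : ∀ i ∈ s, ∀ l, |y i l - a l| ≤ L) {ω : ι → ℝ} (_ : AnnihilatesPolynomials s y ω n),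
    |∑ i ∈ s, ω i * f 0 (y i)| ≤ (∑ i ∈ s, |ω i|) * (d * L) ^ n * M := by
  intro n
  induction n with
  | zero =>
    intro f _ _ hb y hy _ ω _
    refine (Finset.abs_sum_le_sum_abs _ _).trans ?_
    rw [pow_zero, mul_one, Finset.sum_mul]
    refine Finset.sum_le_sum fun i hi => ?_
    rw [abs_mul]
    exact mul_le_mul_of_nonneg_left (hb 0 (by simp) _ (hy i hi)) (abs_nonneg _)
  | succ n ih =>
    intro f hc hd hb y hy hyL ω hω
    have hsum : ∀ (α : Fin d → ℕ) (l : Fin d),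
        ∑ m, (α + Pi.single l 1 : Fin d → ℕ) m = ∑ m, α m + 1 := fun α l => by
      simp [Finset.sum_add_distrib]
    have hmem : ∀ t ∈ Set.Icc (0 : ℝ) 1, ∀ i ∈ s, a + t • (y i - a) ∈ A := fun t ht i hi =>
      hA.add_smul_sub_mem ha (hy i hi) ht
    -- The induction hypothesis for the partial derivative in direction l. The linear factor in the
    -- weights costs one L and one order of annihilation.
    have hbound : ∀ t ∈ Set.Icc (0 : ℝ) 1, ∀ l : Fin d,
        |∑ i ∈ s, ω i * (y i l - a l) * f (0 + Pi.single l 1) (a + t • (y i - a))| ≤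
          (∑ i ∈ s, |ω i|) * L * (d * L) ^ n * M := by
      intro t ht l
      refine (ih (f := fun α => f (α + Pi.single l 1)) (fun α hα => hc _ (by rw [hsum]; omega))
        (fun α m hα z hz => by
          rw [add_right_comm]
          exact hd _ m (by rw [hsum]; omega) z hz)
        (fun α hα => hb _ (by rw [hsum]; omega)) (hmem t ht) (fun i hi m => ?_)
        (hω.contract a t l)).trans ?_
      · have e : (a + t • (y i - a)) m - a m = t * (y i m - a m) := by simp
        rw [e, abs_mul, abs_of_nonneg ht.1]
        exact (mul_le_of_le_one_left (abs_nonneg _) ht.2).trans (hyL i hi m)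
      · gcongr
        rw [Finset.sum_mul]
        refine Finset.sum_le_sum fun i hi => ?_
        rw [abs_mul]
        exact mul_le_mul_of_nonneg_left (hyL i hi l) (abs_nonneg _)
    -- In place of a Taylor expansion, all nodes are moved along segments from a. At t = 0 they
    -- coincide and the functional vanishes on the constant f a. The t-derivative is a sum of d
    -- functionals of lower order, whence the factor d per step.
    have hmv := norm_image_sub_le_of_norm_deriv_le_segment_01'
      (f := fun t : ℝ => ∑ i ∈ s, ω i * f 0 (a + t • (y i - a)))
      (f' := fun t : ℝ => ∑ l, ∑ i ∈ s,
        ω i * (y i l - a l) * f (0 + Pi.single l 1) (a + t • (y i - a)))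
      (C := (∑ i ∈ s, |ω i|) * (d * L) ^ (n + 1) * M)
      (fun t ht => by
        rw [Finset.sum_comm]
        refine HasDerivAt.hasDerivWithinAt (HasDerivAt.fun_sum fun i hi => ?_)
        have hz := hAU (hmem t ht i hi)
        -- The segment is not parallel to an axis, so the chain rule needs a full derivative.
        have h1 := hasFDerivAt_of_lineDeriv_continuousAt hU
          (fun l z hz => hd 0 l (by simp) z hz) hz
          (fun l => (hc _ (by rw [hsum]; simp)).continuousAt (hU.mem_nhds hz))
        have h2 : HasDerivAt (fun t : ℝ => a + t • (y i - a)) (y i - a) t := by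
          simpa using ((hasDerivAt_id t).smul_const (y i - a)).const_add a
        have h3 := (h1.comp_hasDerivAt t h2).const_mul (ω i)
        have e : ∑ l, ω i * (y i l - a l) * f (0 + Pi.single l 1) (a + t • (y i - a)) =
            ω i * (∑ l, f (0 + Pi.single l 1) (a + t • (y i - a)) •
              (EuclideanSpace.proj l : EuclideanSpace ℝ (Fin d) →L[ℝ] ℝ)) (y i - a) := by
          simp only [FunLike.coe_sum, FunLike.coe_smul, Finset.sum_apply, Pi.smul_apply,
            PiLp.proj_apply, smul_eq_mul, Finset.mul_sum, PiLp.sub_apply]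
          exact Finset.sum_congr rfl fun l _ => by ring
        rw [e]
        exact h3)
      (fun t ht => by
        rw [Real.norm_eq_abs]
        refine (Finset.abs_sum_le_sum_abs _ _).trans ?_
        refine (Finset.sum_le_sum fun l _ => hbound t ⟨ht.1, ht.2.le⟩ l).trans ?_
        rw [Finset.sum_const, Finset.card_univ, Fintype.card_fin, nsmul_eq_mul]
        exact le_of_eq (by ring))
    have h0 : ∑ i ∈ s, ω i * f 0 a = 0 := by
      have := hω 1 (by simp)
      simp only [map_one, mul_one] at this
      rw [← Finset.sum_mul, this, zero_mul]
    simpa [h0] using hmv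

/-! ### Bounding boxes -/

section BoundingBox

variable {d N : ℕ} {x : Fin N → EuclideanSpace ℝ (Fin d)} {v w : Finset (Fin N)} {i j : Fin N}

theorem boxMin_le (hi : i ∈ v) (l : Fin d) : boxMin x v l ≤ x i l :=
  csInf_le (v.finite_toSet.image _).bddBelow ⟨i, hi, rfl⟩

theorem le_boxMax (hi : i ∈ v) (l : Fin d) : x i l ≤ boxMax x v l :=
  le_csSup (v.finite_toSet.image _).bddAbove ⟨i, hi, rfl⟩

theorem exists_boxMin (hv : v.Nonempty) (l : Fin d) : ∃ i ∈ v, x i l = boxMin x v l := by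
  have := (hv.to_set.image fun i => x i l).csInf_mem (v.finite_toSet.image _)
  simpa [boxMin] using this

theorem exists_boxMax (hv : v.Nonempty) (l : Fin d) : ∃ i ∈ v, x i l = boxMax x v l := by
  have := (hv.to_set.image fun i => x i l).csSup_mem (v.finite_toSet.image _)
  simpa [boxMax] using this

theorem abs_sub_le_edgeLength (hi : i ∈ v) (hj : j ∈ v) (l : Fin d) :
    |x i l - x j l| ≤ edgeLength x v l := by
  have h1 := boxMin_le (x := x) hi l
  have h2 := boxMin_le (x := x) hj l
  have h3 := le_boxMax (x := x) hi l
  have h4 := le_boxMax (x := x) hj l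
  rw [edgeLength, abs_le]
  constructor <;> linarith

theorem edgeLength_nonneg (hv : v.Nonempty) (l : Fin d) : 0 ≤ edgeLength x v l := by
  obtain ⟨i, hi⟩ := hv
  simpa using abs_sub_le_edgeLength (x := x) hi hi l

theorem edgeLength_mono (hv : v.Nonempty) (h : v ⊆ w) (l : Fin d) :
    edgeLength x v l ≤ edgeLength x w l := by
  obtain ⟨i, hi, hil⟩ := exists_boxMax (x := x) hv l
  obtain ⟨j, hj, hjl⟩ := exists_boxMin (x := x) hv l
  rw [edgeLength, ← hil, ← hjl]
  exact (le_abs_self _).trans (abs_sub_le_edgeLength (h hi) (h hj) l)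

theorem mem_boundingBox (hi : i ∈ v) : x i ∈ boundingBox x v :=
  fun l => ⟨boxMin_le hi l, le_boxMax hi l⟩

theorem convex_boundingBox : Convex ℝ (boundingBox x v) := by
  have : boundingBox x v =
      ⋂ l : Fin d, (EuclideanSpace.proj l : EuclideanSpace ℝ (Fin d) →L[ℝ] ℝ) ⁻¹'
        Set.Icc (boxMin x v l) (boxMax x v l) := by
    ext z
    simp [boundingBox]
  rw [this]
  exact convex_iInter fun l => (convex_Icc _ _).linear_preimage
    (EuclideanSpace.proj l : EuclideanSpace ℝ (Fin d) →L[ℝ] ℝ).toLinearMap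

theorem isBounded_boundingBox : Bornology.IsBounded (boundingBox x v) := by
  refine ((PiLp.antilipschitzWith_ofLp 2 (fun _ : Fin d => ℝ)).isBounded_preimage
    (Metric.isBounded_Icc (boxMin x v) (boxMax x v))).subset fun z hz => ?_
  exact ⟨fun l => (hz l).1, fun l => (hz l).2⟩

theorem edgeLength_le_diam (hv : v.Nonempty) (l : Fin d) :
    edgeLength x v l ≤ Metric.diam (boundingBox x v) := by
  obtain ⟨i, hi, hil⟩ := exists_boxMax (x := x) hv l
  obtain ⟨j, hj, hjl⟩ := exists_boxMin (x := x) hv l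
  rw [edgeLength, ← hil, ← hjl]
  refine le_trans ?_ (Metric.dist_le_diam_of_mem isBounded_boundingBox (mem_boundingBox hi)
    (mem_boundingBox hj))
  rw [dist_eq_norm]
  have := PiLp.norm_apply_le (x i - x j) l
  rw [Real.norm_eq_abs] at this
  exact (le_abs_self _).trans this

theorem convexHull_subset_boundingBox : convexHull ℝ (x '' v) ⊆ boundingBox x v :=
  convexHull_min (by rintro _ ⟨i, hi, rfl⟩; exact mem_boundingBox hi) convex_boundingBox

end BoundingBox

/-! ### Decay of the kernel entries -/

theorem setDist_le {d : ℕ} {A B : Set (EuclideanSpace ℝ (Fin d))} {a b : EuclideanSpace ℝ (Fin d)}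
    (ha : a ∈ A) (hb : b ∈ B) : setDist A B ≤ dist a b :=
  csInf_le ⟨0, by rintro _ ⟨a, -, b, -, rfl⟩; exact dist_nonneg⟩ ⟨a, ha, b, hb, rfl⟩

/-- The pairing of an asymptotically smooth kernel with two functionals that annihilate
polynomials and live in boxes of edge lengths `L` and `L'` with distance `δ`. -/
theorem abs_kernelPairing_le {d : ℕ} {Ω : Set (EuclideanSpace ℝ (Fin d))} (hΩ : IsOpen Ω)
    (hΩ' : Convex ℝ Ω) {s : ℕ} {k : EuclideanSpace ℝ (Fin d) → EuclideanSpace ℝ (Fin d) → ℝ}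
    {D : (Fin d → ℕ) → (Fin d → ℕ) →
      EuclideanSpace ℝ (Fin d) → EuclideanSpace ℝ (Fin d) → ℝ}
    (hD : IsMixedPartials Ω s k D) {c r : ℝ} (hc : 0 < c) (hr : 0 < r)
    (hDb : ∀ α β : Fin d → ℕ, ∑ l, α l ≤ s → ∑ l, β l ≤ s →
      ∀ x ∈ Ω, ∀ y ∈ Ω, x ≠ y →
        |D α β x y| ≤
          c * ((∑ l, (α l + β l)).factorial : ℝ) / (r * ‖x - y‖) ^ (∑ l, (α l + β l)))
    {N : ℕ} {x : Fin N → EuclideanSpace ℝ (Fin d)} (hx : ∀ i, x i ∈ Ω)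
    {v v' : Finset (Fin N)} (hv : v.Nonempty) (hv' : v'.Nonempty) {L L' δ : ℝ}
    (hL : ∀ l, edgeLength x v l ≤ L) (hL' : ∀ l, edgeLength x v' l ≤ L') (hL0 : 0 ≤ L)
    (hL0' : 0 ≤ L') (hδ : 0 < δ)
    (hδv : δ ≤ setDist (boundingBox x v) (boundingBox x v')) {ω ω' : Fin N → ℝ}
    (hω : ∀ i ∉ v, ω i = 0) (hω' : ∀ i ∉ v', ω' i = 0)
    (ha : AnnihilatesPolynomials v x ω s) (ha' : AnnihilatesPolynomials v' x ω' s) :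
    |kernelPairing x k ω ω'| ≤
      c * (s + s).factorial * (d ^ (s + s) / r ^ (s + s)) * ((∑ i ∈ v, |ω i|) * ∑ i ∈ v', |ω' i|) *
        (L * L' / δ ^ 2) ^ s := by
  -- Convex hulls of the points replace the boxes as domains: a box may leave Ω, a hull cannot, and
  -- hulls inherit the distance δ.
  have hsub : ∀ w : Finset (Fin N), convexHull ℝ (x '' w) ⊆ Ω := fun w =>
    convexHull_min (by rintro _ ⟨i, -, rfl⟩; exact hx i) hΩ'
  have hmem : ∀ {w : Finset (Fin N)}, ∀ i ∈ w, x i ∈ convexHull ℝ (x '' w) := fun i hi =>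
    subset_convexHull ℝ _ ⟨i, hi, rfl⟩
  have hsep : ∀ a ∈ convexHull ℝ (x '' v), ∀ b ∈ convexHull ℝ (x '' v'), δ ≤ dist a b :=
    fun a h b h' => hδv.trans
      (setDist_le (convexHull_subset_boundingBox h) (convexHull_subset_boundingBox h'))
  have hne : ∀ a ∈ convexHull ℝ (x '' v), ∀ b ∈ convexHull ℝ (x '' v'), a ≠ b :=
    fun a h b h' e => by
      have := hsep a h b h'
      rw [e, dist_self] at this
      exact absurd this (not_le.2 hδ)
  have hadd : ∀ (α : Fin d → ℕ) (l : Fin d),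
      ∑ m, (α + Pi.single l 1 : Fin d → ℕ) m = ∑ m, α m + 1 := fun α l => by
    simp [Finset.sum_add_distrib]
  obtain ⟨i₀, hi₀⟩ := hv
  obtain ⟨j₀, hj₀⟩ := hv'
  set M : ℝ := c * (s + s).factorial / (r * δ) ^ (s + s) with hM
  have hM0 : 0 ≤ M := by positivity
  -- The cancellation in y, for x-derivatives of the top order s. The result is the derivative bound
  -- that the cancellation in x requires below.
  have hinner : ∀ α : Fin d → ℕ, ∑ l, α l = s → ∀ z ∈ convexHull ℝ (x '' v),
      |∑ i ∈ v', ω' i * D α 0 z (x i)| ≤ (∑ i ∈ v', |ω' i|) * (d * L') ^ s * M := by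
    intro α hα z hz
    have hUo : IsOpen (Ω ∩ {z}ᶜ) := hΩ.inter isOpen_compl_singleton
    refine AnnihilatesPolynomials.abs_sum_le (f := fun β => D α β z) hUo
      (convex_convexHull ℝ (x '' v')) (fun b hb => ⟨hsub _ hb, (hne z hz b hb).symm⟩) hL0' hM0
      (hmem j₀ hj₀) (fun β hβ => ?_) (fun β l hβ y hy => ?_) (fun β hβ y hy => ?_)
      (fun i hi => hmem i hi) (fun i hi l => (abs_sub_le_edgeLength hi hj₀ l).trans (hL' l)) ha'
    · exact (hD.continuousOn α β hα.le hβ).comp (f := fun y => (z, y)) (by fun_prop)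
        fun y hy => ⟨hsub _ hz, hy.1, fun e => hy.2 e.symm⟩
    · exact hD.deriv_right α β l hα.le hβ z (hsub _ hz) y hy.1 fun e => hy.2 e.symm
    · refine (hDb α β hα.le hβ.le z (hsub _ hz) y (hsub _ hy) (hne z hz y hy)).trans ?_
      rw [Finset.sum_add_distrib, hα, hβ, hM, ← dist_eq_norm]
      gcongr
      exact hsep z hz y hy
  -- As a function of x, the inner sum is singular only at the nodes of v', so removing these
  -- finitely many points suffices.
  have hUo : IsOpen (Ω ∩ (x '' v')ᶜ) := hΩ.inter (v'.finite_toSet.image x).isClosed.isOpen_compl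
  have hUne : ∀ y ∈ Ω ∩ (x '' v')ᶜ, ∀ i ∈ v', y ≠ x i := fun y hy i hi e => hy.2 ⟨i, hi, e.symm⟩
  have houter := AnnihilatesPolynomials.abs_sum_le (s := v)
    (f := fun α z => ∑ i ∈ v', ω' i * D α 0 z (x i)) (n := s)
    (M := (∑ i ∈ v', |ω' i|) * (d * L') ^ s * M) hUo (convex_convexHull ℝ (x '' v))
    (fun b hb => ⟨hsub _ hb, by
      rintro ⟨i, hi, e⟩
      exact hne b hb (x i) (hmem i hi) e.symm⟩) hL0 (by positivity)
    (hmem i₀ hi₀)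
    (fun α hα => continuousOn_finsetSum _ fun i hi => continuousOn_const.mul <|
      (hD.continuousOn α 0 hα (by simp)).comp (f := fun y => (y, x i)) (by fun_prop)
        fun y hy => ⟨hy.1, hx i, hUne y hy i hi⟩)
    (fun α l hα y hy => by
      have : ∀ i ∈ v', HasLineDerivAt ℝ (fun z => ω' i * D α 0 z (x i))
          (ω' i * D (α + Pi.single l 1) 0 y (x i)) y (EuclideanSpace.single l 1) := fun i hi => by
        have := hD.deriv_left α 0 l hα (by simp) y hy.1 (x i) (hx i) (hUne y hy i hi)
        unfold HasLineDerivAt at this ⊢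
        exact this.const_mul _
      unfold HasLineDerivAt at this ⊢
      exact HasDerivAt.fun_sum this)
    (fun α hα z hz => hinner α hα z hz) (fun i hi => hmem i hi)
    (fun i hi l => (abs_sub_le_edgeLength hi hi₀ l).trans (hL l)) ha
  have hpair : kernelPairing x k ω ω' = ∑ i ∈ v, ω i * ∑ i' ∈ v', ω' i' * D 0 0 (x i) (x i') := by
    rw [kernelPairing, ← Finset.sum_subset (Finset.subset_univ v)
      (fun i _ hi => by simp [hω i hi])]
    refine Finset.sum_congr rfl fun i hi => ?_
    rw [← Finset.sum_subset (Finset.subset_univ v') (fun i _ hi => by simp [hω' i hi]),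
      Finset.mul_sum]
    refine Finset.sum_congr rfl fun j hj => ?_
    rw [hD.zero _ (hx i) _ (hx j) (hne _ (hmem i hi) _ (hmem j hj)), mul_assoc]
  rw [hpair]
  refine houter.trans (le_of_eq ?_)
  rw [hM, div_pow, ← pow_mul, two_mul]
  field_simp
  ring

/-! ### Sums over cluster trees -/

/-- The sum of `g` over the clusters of the inner nodes of a tree. -/
def ClusterTree.innerSum {N : ℕ} (g : Finset (Fin N) → ℝ) : ClusterTree N → ℝ
  | .leaf _ => 0
  | .node v t₁ t₂ => g v + t₁.innerSum g + t₂.innerSum g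

/-- The length of a longest edge of the bounding box. -/
noncomputable def maxEdge {d N : ℕ} (x : Fin N → EuclideanSpace ℝ (Fin d))
    (v : Finset (Fin N)) : ℝ :=
  ⨆ l : Fin d, edgeLength x v l

section Trees

variable {d N : ℕ} {x : Fin N → EuclideanSpace ℝ (Fin d)} {v v₁ v₂ : Finset (Fin N)}

theorem edgeLength_le_maxEdge (l : Fin d) : edgeLength x v l ≤ maxEdge x v :=
  le_ciSup (Set.finite_range _).bddAbove l

theorem maxEdge_nonneg : 0 ≤ maxEdge x v := by
  refine Real.iSup_nonneg fun l => ?_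
  rcases v.eq_empty_or_nonempty with rfl | hv
  · simp [edgeLength, boxMax, boxMin]
  · exact edgeLength_nonneg hv l

theorem maxEdge_le_diam (hv : v.Nonempty) : maxEdge x v ≤ Metric.diam (boundingBox x v) :=
  Real.iSup_le (fun l => edgeLength_le_diam hv l) Metric.diam_nonneg

theorem maxEdge_pos (hx : Function.Injective x) (hv : 2 ≤ v.card) : 0 < maxEdge x v := by
  obtain ⟨i, hi, j, hj, hij⟩ := Finset.one_lt_card.1 hv
  obtain ⟨l, hl⟩ : ∃ l, x i l ≠ x j l := by
    by_contra h
    push Not at h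
    exact hij (hx (by ext l; exact h l))
  refine lt_of_lt_of_le (abs_pos.2 (sub_ne_zero.2 hl)) ?_
  exact (abs_sub_le_edgeLength hi hj l).trans (edgeLength_le_maxEdge l)

theorem IsBisection.card_add (h : IsBisection x v v₁ v₂) : v₁.card + v₂.card = v.card := by
  obtain ⟨-, -, hd, hu, -⟩ := h
  rw [← hu, Finset.card_union_of_disjoint hd]

/-- Both sons are nonempty and differ by at most two points; the extreme case is a split into 1 and
3. -/
theorem IsBisection.card_le_left (h : IsBisection x v v₁ v₂) : v.card ≤ 4 * v₁.card := by
  have := h.card_add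
  obtain ⟨h1, -, -, -, h3, h4, -⟩ := h
  have := h1.card_pos
  omega

theorem IsBisection.card_le_right (h : IsBisection x v v₁ v₂) : v.card ≤ 4 * v₂.card := by
  have := h.card_add
  obtain ⟨-, h1, -, -, h3, h4, -⟩ := h
  have := h1.card_pos
  omega

theorem IsBisection.two_le_card (h : IsBisection x v v₁ v₂) : 2 ≤ v.card := by
  have := h.card_add
  have h1 := h.1.card_pos
  have h2 := h.2.1.card_pos
  omega

theorem IsBisection.subset_left (h : IsBisection x v v₁ v₂) : v₁ ⊆ v :=
  h.2.2.2.1 ▸ Finset.subset_union_left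

theorem IsBisection.subset_right (h : IsBisection x v v₁ v₂) : v₂ ⊆ v :=
  h.2.2.2.1 ▸ Finset.subset_union_right

/-- A longest edge is at least halved in one of the sons. -/
theorem IsBisection.exists_half (h : IsBisection x v v₁ v₂) :
    ∃ l, edgeLength x v l = maxEdge x v ∧
      (edgeLength x v₁ l ≤ maxEdge x v / 2 ∨ edgeLength x v₂ l ≤ maxEdge x v / 2) := by
  have hs1 := h.subset_left
  have hs2 := h.subset_right
  obtain ⟨h1, h2, -, -, -, -, l, hl, m, hm1, hm2⟩ := h
  have : Nonempty (Fin d) := ⟨l⟩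
  have hmax : edgeLength x v l = maxEdge x v := le_antisymm (edgeLength_le_maxEdge l) (ciSup_le hl)
  refine ⟨l, hmax, ?_⟩
  obtain ⟨i, hi, hil⟩ := exists_boxMin (x := x) h1 l
  obtain ⟨i', hi', hil'⟩ := exists_boxMax (x := x) h1 l
  obtain ⟨j, hj, hjl⟩ := exists_boxMax (x := x) h2 l
  obtain ⟨j', hj', hjl'⟩ := exists_boxMin (x := x) h2 l
  have h3 := hm1 i hi
  have h4 := hm2 j hj
  have h5 := (le_abs_self _).trans (abs_sub_le_edgeLength (x := x) (hs1 hi') (hs2 hj') l)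
  have e1 : edgeLength x v₁ l = x i' l - x i l := by rw [edgeLength, ← hil, ← hil']
  have e2 : edgeLength x v₂ l = x j l - x j' l := by rw [edgeLength, ← hjl, ← hjl']
  rw [← hmax, e1, e2]
  by_contra! hcon
  linarith [hcon.1, hcon.2]

theorem IsBisectionTree.nonempty {m : ℕ} {t : ClusterTree N} (h : IsBisectionTree x m t) :
    t.cluster.Nonempty := by
  cases h with
  | leaf v hne => exact hne
  | node v t₁ t₂ hs => exact hs.1.mono hs.subset_left

/-- Entropy gain of a split: a + b ≥ 2a gives at least a log 2 from the smaller part and nothing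
negative from the larger, and a is at least a quarter of the total. -/
theorem mul_log_le_of_le_four_mul {a b : ℝ} (ha : 0 < a) (hab : a ≤ b) (h : a + b ≤ 4 * a) :
    a + b ≤ 4 / Real.log 2 *
      ((a + b) * Real.log (a + b) - a * Real.log a - b * Real.log b) := by
  have hl : 0 < Real.log 2 := Real.log_pos one_lt_two
  have h1 : Real.log 2 + Real.log a ≤ Real.log (a + b) := by
    rw [← Real.log_mul two_ne_zero ha.ne']
    exact Real.log_le_log (by positivity) (by linarith)
  have h2 : Real.log b ≤ Real.log (a + b) := Real.log_le_log (by linarith) (by linarith)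
  have h3 : a * Real.log 2 ≤
      (a + b) * Real.log (a + b) - a * Real.log a - b * Real.log b := by
    nlinarith [mul_le_mul_of_nonneg_left h1 ha.le,
      mul_le_mul_of_nonneg_left h2 (ha.le.trans hab)]
  rw [div_mul_eq_mul_div, le_div_iff₀ hl]
  nlinarith

/-- The gains of n log n telescope down the tree and its value at the leaves is nonnegative. No
bound on the depth of the tree is needed. -/
theorem IsBisectionTree.innerSum_card_le {m : ℕ} {t : ClusterTree N}
    (h : IsBisectionTree x m t) :
    t.innerSum (fun v => (v.card : ℝ)) ≤
      4 / Real.log 2 * (t.cluster.card * Real.log t.cluster.card) := by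
  have hl : 0 < Real.log 2 := Real.log_pos one_lt_two
  induction h with
  | leaf v hne hcard =>
    have := Real.log_natCast_nonneg v.card
    simp only [ClusterTree.innerSum, ClusterTree.cluster]
    positivity
  | node v t₁ t₂ hs h₁ h₂ ih₁ ih₂ =>
    simp only [ClusterTree.innerSum, ClusterTree.cluster]
    have hc : (t₁.cluster.card : ℝ) + t₂.cluster.card = v.card := mod_cast hs.card_add
    have c1 : (v.card : ℝ) ≤ 4 * t₁.cluster.card := mod_cast hs.card_le_left
    have c2 : (v.card : ℝ) ≤ 4 * t₂.cluster.card := mod_cast hs.card_le_right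
    have p1 : (0 : ℝ) < t₁.cluster.card := mod_cast hs.1.card_pos
    have p2 : (0 : ℝ) < t₂.cluster.card := mod_cast hs.2.1.card_pos
    have key : (v.card : ℝ) ≤ 4 / Real.log 2 * (v.card * Real.log v.card -
        t₁.cluster.card * Real.log t₁.cluster.card -
        t₂.cluster.card * Real.log t₂.cluster.card) := by
      rw [← hc] at c1 c2 ⊢
      rcases le_total (t₁.cluster.card : ℝ) t₂.cluster.card with hle | hle
      · exact mul_log_le_of_le_four_mul p1 hle c1
      · have := mul_log_le_of_le_four_mul p2 hle (by linarith)
        rw [add_comm (t₁.cluster.card : ℝ)]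
        linarith
    rw [mul_sub, mul_sub] at key
    linarith

theorem div_add_mono {D a b : ℝ} (hD : 0 < D) (ha : 0 ≤ a) (hab : a ≤ b) :
    a / (D + a) ≤ b / (D + b) := by
  rw [div_le_div_iff₀ (by positivity) (by linarith)]
  nlinarith

/-- Clusters whose size differs from `D` contribute little: along the tree the longest edges
decay geometrically on average. -/
theorem IsBisectionTree.innerSum_scale_le {m : ℕ} {t : ClusterTree N}
    (h : IsBisectionTree x m t) {D : ℝ} (hD : 0 < D) :
    t.innerSum (fun v => v.card * (maxEdge x v * D / ((D + maxEdge x v) * (2 * D + maxEdge x v))))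
      ≤ 4 * t.cluster.card * ∑ l, edgeLength x t.cluster l / (D + edgeLength x t.cluster l) := by
  induction h with
  | leaf v hne hcard =>
    simp only [ClusterTree.innerSum, ClusterTree.cluster]
    have : 0 ≤ ∑ l, edgeLength x v l / (D + edgeLength x v l) :=
      Finset.sum_nonneg fun l _ => by
        have := edgeLength_nonneg (x := x) hne l
        positivity
    positivity
  | node v t₁ t₂ hs h₁ h₂ ih₁ ih₂ =>
    simp only [ClusterTree.innerSum, ClusterTree.cluster]
    -- Each summand of P is below 1 and increases with its edge. It is nearly constant for edges far
    -- above D and nearly linear far below, so halving an edge has a substantial effect only at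
    -- scale D.
    set P : Finset (Fin N) → ℝ := fun w => ∑ l, edgeLength x w l / (D + edgeLength x w l) with hP
    change _ ≤ 4 * _ * P v
    change _ ≤ 4 * _ * P _ at ih₁
    change _ ≤ 4 * _ * P _ at ih₂
    set L := maxEdge x v with hL
    have hL0 : 0 ≤ L := maxEdge_nonneg
    -- Exactly the decrease of a / (D + a) when a passes from L to L / 2. The son with the halved
    -- edge holds at least a quarter of the points, so 4 |v| P v loses at least |v| G.
    set G := L * D / ((D + L) * (2 * D + L)) with hG
    have hG0 : 0 ≤ G := by positivity
    have hGe : L / 2 / (D + L / 2) + G = L / (D + L) := by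
      rw [hG]
      field_simp
      ring
    have hmono : ∀ w : Finset (Fin N), w.Nonempty → w ⊆ v → P w ≤ P v := fun w hw hwv =>
      Finset.sum_le_sum fun l _ =>
        div_add_mono hD (edgeLength_nonneg hw l) (edgeLength_mono hw hwv l)
    obtain ⟨l, hl, hhalf⟩ := hs.exists_half
    have hdrop : ∀ w : Finset (Fin N), w.Nonempty → w ⊆ v → edgeLength x w l ≤ L / 2 →
        P w + G ≤ P v := by
      intro w hw hwv hwl
      simp only [hP]
      rw [← Finset.add_sum_erase _ _ (Finset.mem_univ l),
        ← Finset.add_sum_erase (a := l) _ (fun l => edgeLength x v l / (D + edgeLength x v l))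
          (Finset.mem_univ l)]
      have h1 := div_add_mono hD (edgeLength_nonneg hw l) hwl
      have h2 : ∑ l ∈ Finset.univ.erase l, edgeLength x w l / (D + edgeLength x w l) ≤
          ∑ l ∈ Finset.univ.erase l, edgeLength x v l / (D + edgeLength x v l) :=
        Finset.sum_le_sum fun l _ =>
          div_add_mono hD (edgeLength_nonneg hw l) (edgeLength_mono hw hwv l)
      rw [hl]
      linarith
    have hc : (t₁.cluster.card : ℝ) + t₂.cluster.card = v.card := mod_cast hs.card_add
    have c1 : (v.card : ℝ) ≤ 4 * t₁.cluster.card := mod_cast hs.card_le_left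
    have c2 : (v.card : ℝ) ≤ 4 * t₂.cluster.card := mod_cast hs.card_le_right
    have p1 : (0 : ℝ) ≤ t₁.cluster.card := Nat.cast_nonneg _
    have p2 : (0 : ℝ) ≤ t₂.cluster.card := Nat.cast_nonneg _
    have m1 := mul_le_mul_of_nonneg_left (hmono _ hs.1 hs.subset_left) p1
    have m2 := mul_le_mul_of_nonneg_left (hmono _ hs.2.1 hs.subset_right) p2
    have e : (v.card : ℝ) * P v = t₁.cluster.card * P v + t₂.cluster.card * P v := by
      rw [← hc, add_mul]
    rcases hhalf with hh | hh
    · have d1 := mul_le_mul_of_nonneg_left (hdrop _ hs.1 hs.subset_left hh) p1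
      have := mul_le_mul_of_nonneg_right c1 hG0
      linarith
    · have d2 := mul_le_mul_of_nonneg_left (hdrop _ hs.2.1 hs.subset_right hh) p2
      have := mul_le_mul_of_nonneg_right c2 hG0
      linarith

end Trees

/-! ### Orthonormality and vanishing moments of samplets -/

section Basis

variable {d N : ℕ} {x : Fin N → EuclideanSpace ℝ (Fin d)} {q : ℕ}

theorem moment_sum {ι : Type*} (s : Finset ι) (α : Fin d → ℕ) (c : ι → ℝ)
    (φ : ι → Fin N → ℝ) : moment x α (∑ a ∈ s, c a • φ a) = ∑ a ∈ s, c a * moment x α (φ a) := by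
  simp only [moment, Finset.sum_apply, Pi.smul_apply, smul_eq_mul, Finset.sum_mul, Finset.mul_sum]
  rw [Finset.sum_comm]
  exact Finset.sum_congr rfl fun a _ => Finset.sum_congr rfl fun i _ => by ring

/-- The members of the list are orthonormal coefficient vectors supported in the cluster `v`. -/
structure IsOrthonormalOn (v : Finset (Fin N)) (Φ : List (Fin N → ℝ)) : Prop where
  pairwise : Φ.Pairwise fun φ ψ => φ ⬝ᵥ ψ = 0
  norm_sq : ∀ φ ∈ Φ, φ ⬝ᵥ φ = 1
  support : ∀ φ ∈ Φ, ∀ i ∉ v, φ i = 0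

theorem IsOrthonormalOn.dotProduct_get {v : Finset (Fin N)} {Φ : List (Fin N → ℝ)}
    (h : IsOrthonormalOn v Φ) (a b : Fin Φ.length) :
    Φ.get a ⬝ᵥ Φ.get b = if a = b then 1 else 0 := by
  rcases lt_trichotomy a b with hab | rfl | hab
  · rw [if_neg hab.ne]
    exact List.pairwise_iff_get.1 h.pairwise a b hab
  · rw [if_pos rfl]
    exact h.norm_sq _ (List.get_mem _ _)
  · rw [if_neg hab.ne', dotProduct_comm]
    exact List.pairwise_iff_get.1 h.pairwise b a hab

theorem IsOrthonormalOn.append {v₁ v₂ : Finset (Fin N)} {Φ₁ Φ₂ : List (Fin N → ℝ)}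
    (h₁ : IsOrthonormalOn v₁ Φ₁) (h₂ : IsOrthonormalOn v₂ Φ₂) (hd : Disjoint v₁ v₂) :
    IsOrthonormalOn (v₁ ∪ v₂) (Φ₁ ++ Φ₂) where
  pairwise := List.pairwise_append.2 ⟨h₁.pairwise, h₂.pairwise, fun φ hφ ψ hψ =>
    Finset.sum_eq_zero fun i _ => by
      by_cases hi : i ∈ v₁
      · rw [h₂.support ψ hψ i (Finset.disjoint_left.1 hd hi), mul_zero]
      · rw [h₁.support φ hφ i hi, zero_mul]⟩
  norm_sq φ hφ := (List.mem_append.1 hφ).elim (h₁.norm_sq φ) (h₂.norm_sq φ)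
  support φ hφ i hi := by
    rw [Finset.mem_union, not_or] at hi
    exact (List.mem_append.1 hφ).elim (fun h => h₁.support φ h i hi.1)
      fun h => h₂.support φ h i hi.2

theorem IsOrthonormalOn.sublist {v : Finset (Fin N)} {Φ Ψ : List (Fin N → ℝ)}
    (h : IsOrthonormalOn v Φ) (hs : Ψ.Sublist Φ) : IsOrthonormalOn v Ψ :=
  ⟨h.pairwise.sublist hs, fun φ hφ => h.norm_sq φ (hs.subset hφ),
    fun φ hφ => h.support φ (hs.subset hφ)⟩

/-- The estimate uses only unit norms, but these survive multiplication by Q only if the whole row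
is orthonormal. -/
theorem IsQRTransform.isOrthonormalOn {v : Finset (Fin N)} {Φ Ψ : List (Fin N → ℝ)}
    (h : IsQRTransform x q Φ Ψ) (hΦ : IsOrthonormalOn v Φ) : IsOrthonormalOn v Ψ := by
  obtain ⟨-, Q, -, hQ, -, -, rfl⟩ := h
  rw [Matrix.mem_orthogonalGroup_iff'] at hQ
  have key : ∀ c c' : Fin Φ.length,
      (∑ a, Q a c • Φ.get a) ⬝ᵥ (∑ a, Q a c' • Φ.get a) = if c = c' then 1 else 0 := by
    intro c c'
    simp only [sum_dotProduct, dotProduct_sum, smul_dotProduct, dotProduct_smul,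
      hΦ.dotProduct_get, smul_eq_mul, mul_ite, mul_one, mul_zero]
    have := congrFun (congrFun hQ c) c'
    rw [Matrix.mul_apply, Matrix.one_apply] at this
    rw [← this]
    simp [mul_comm]
  refine ⟨?_, ?_, ?_⟩
  · rw [List.pairwise_ofFn]
    intro c c' hc
    rw [key, if_neg hc.ne]
  · intro φ hφ
    obtain ⟨c, rfl⟩ := (List.mem_ofFn' _ _).1 hφ
    simp only [key, if_true]
  · intro φ hφ i hi
    obtain ⟨c, rfl⟩ := (List.mem_ofFn' _ _).1 hφ
    change (∑ a, Q a c • Φ.get a) i = 0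
    rw [Finset.sum_apply]
    refine Finset.sum_eq_zero fun a _ => ?_
    rw [Pi.smul_apply, hΦ.support _ (List.get_mem _ _) i hi, smul_zero]

theorem IsQRTransform.length_eq {Φ Ψ : List (Fin N → ℝ)} (h : IsQRTransform x q Φ Ψ) :
    Ψ.length = Φ.length := by
  obtain ⟨-, Q, -, -, -, -, rfl⟩ := h
  exact List.length_ofFn

/-- The moments of the new functions are the rows of Qᵀ Mᵀ = R, and the rows of an upper triangular
matrix with m_q columns vanish from index m_q on. -/
theorem IsQRTransform.moment_eq_zero {Φ Ψ : List (Fin N → ℝ)} (h : IsQRTransform x q Φ Ψ)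
    {σ : Fin N → ℝ} (hσ : σ ∈ Ψ.drop (numMonomials d q)) {α : Fin d → ℕ} (hα : ∑ l, α l ≤ q) :
    moment x α σ = 0 := by
  obtain ⟨e, Q, R, hQ, hR, hM, rfl⟩ := h
  rw [Matrix.mem_orthogonalGroup_iff'] at hQ
  obtain ⟨n, hn, rfl⟩ := List.mem_iff_getElem.1 hσ
  rw [List.getElem_drop, List.getElem_ofFn, moment_sum]
  rw [List.length_drop, List.length_ofFn] at hn
  set c : Fin Φ.length := ⟨numMonomials d q + n, by omega⟩ with hc
  set b := e.symm ⟨α, hα⟩ with hb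
  have h1 : ∀ a, moment x α (Φ.get a) = (Q * R) a b := fun a => by
    rw [← hM]
    simp [hb]
  simp_rw [h1]
  have h2 : ∑ a, Q a c * (Q * R) a b = (Q.transpose * (Q * R)) c b := by
    rw [Matrix.mul_apply]
    simp
  rw [h2, ← Matrix.mul_assoc, hQ, Matrix.one_mul]
  exact hR c b (by simp only [hc]; omega)

/-- What the error estimate needs to know about a samplet `p.2` of the cluster `p.1`. -/
structure IsSamplet (x : Fin N → EuclideanSpace ℝ (Fin d)) (q : ℕ)
    (p : Finset (Fin N) × (Fin N → ℝ)) : Prop where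
  two_le_card : 2 ≤ p.1.card
  norm_sq : p.2 ⬝ᵥ p.2 = 1
  support : ∀ i ∉ p.1, p.2 i = 0
  moment_eq_zero : ∀ α : Fin d → ℕ, ∑ l, α l ≤ q → moment x α p.2 = 0

/-- The length bound feeds the last claim: two sons supply at most 2 m_q scaling functions, so at
most m_q samplets remain at a node. Sums over samplets thereby reduce to sums over inner clusters.
-/
theorem IsSampletConstruction.invariants {t : ClusterTree N} {Φ : List (Fin N → ℝ)}
    {S : List (Finset (Fin N) × (Fin N → ℝ))} (h : IsSampletConstruction x q t Φ S)
    (ht : IsBisectionTree x (numMonomials d q) t) :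
    Φ.length ≤ numMonomials d q ∧ IsOrthonormalOn t.cluster Φ ∧ (∀ p ∈ S, IsSamplet x q p) ∧
      ∀ g : Finset (Fin N) → ℝ, (∀ v, 0 ≤ g v) →
        (S.map fun p => g p.1).sum ≤ numMonomials d q * t.innerSum g := by
  induction h with
  | leaf v L hL hv =>
    cases ht with
    | leaf _ hne hcard =>
      refine ⟨?_, ⟨?_, ?_, ?_⟩, by simp, by simp [ClusterTree.innerSum]⟩
      · rw [List.length_map, ← List.toFinset_card_of_nodup hL, hv]
        exact hcard
      · rw [List.pairwise_map]
        refine hL.imp fun {i j} hij => ?_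
        simp [hij]
      · intro φ hφ
        obtain ⟨i, -, rfl⟩ := List.mem_map.1 hφ
        simp
      · intro φ hφ j hj
        obtain ⟨i, hi, rfl⟩ := List.mem_map.1 hφ
        refine Pi.single_eq_of_ne (fun e => hj ?_) _
        rw [e, ClusterTree.cluster, ← hv]
        exact List.mem_toFinset.2 hi
  | node v t₁ t₂ Φ₁ Φ₂ Ψ S₁ S₂ h₁ h₂ hΨ ih₁ ih₂ =>
    cases ht with
    | node _ _ _ hs ht₁ ht₂ =>
      obtain ⟨l₁, o₁, s₁, g₁⟩ := ih₁ ht₁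
      obtain ⟨l₂, o₂, s₂, g₂⟩ := ih₂ ht₂
      have hlen : Ψ.length = Φ₁.length + Φ₂.length := by
        rw [hΨ.length_eq, List.length_append]
      have o : IsOrthonormalOn v Ψ := by
        have := hΨ.isOrthonormalOn (o₁.append o₂ hs.2.2.1)
        rwa [hs.2.2.2.1] at this
      refine ⟨by simp, o.sublist (List.take_sublist _ _), fun p hp => ?_, fun g hg => ?_⟩
      · rw [List.mem_append, List.mem_append] at hp
        rcases hp with (hp | hp) | hp
        · obtain ⟨σ, hσ, rfl⟩ := List.mem_map.1 hp
          exact ⟨hs.two_le_card, o.norm_sq _ (List.mem_of_mem_drop hσ),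
            o.support _ (List.mem_of_mem_drop hσ), fun α hα => hΨ.moment_eq_zero hσ hα⟩
        · exact s₁ p hp
        · exact s₂ p hp
      · have e : ((List.map (fun σ => (v, σ)) (List.drop (numMonomials d q) Ψ)).map
            fun p => g p.1).sum = (Ψ.length - numMonomials d q : ℕ) * g v := by
          rw [List.map_map]
          simp [Function.comp_def]
        rw [List.map_append, List.map_append, List.sum_append, List.sum_append, e,
          ClusterTree.innerSum, mul_add, mul_add]
        have : ((Ψ.length - numMonomials d q : ℕ) : ℝ) ≤ numMonomials d q :=
          mod_cast (by omega)
        exact add_le_add (add_le_add (mul_le_mul_of_nonneg_right this (hg v)) (g₁ g hg)) (g₂ g hg)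

end Basis

/-! ### The compression error -/

theorem injective_of_separationRadius_pos {d N : ℕ} {x : Fin N → EuclideanSpace ℝ (Fin d)}
    (h : 0 < separationRadius x) : Function.Injective x := by
  intro i j hij
  by_contra hne
  refine absurd h (not_lt.2 (csInf_le ⟨0, ?_⟩ ⟨i, j, hne, by simp [hij]⟩))
  rintro _ ⟨i, j, -, rfl⟩
  positivity

/-- The square of an entry that the compression removes, and zero for the other entries. -/
noncomputable def compressionError {d N : ℕ} (x : Fin N → EuclideanSpace ℝ (Fin d))
    (k : EuclideanSpace ℝ (Fin d) → EuclideanSpace ℝ (Fin d) → ℝ) (η : ℝ)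
    (p p' : Finset (Fin N) × (Fin N → ℝ)) : ℝ :=
  open Classical in if Admissible x η p.1 p'.1 then kernelPairing x k p.2 p'.2 ^ 2 else 0

theorem sum_fin_get_eq_sum_map {α : Type*} (l : List α) (f : α → ℝ) :
    ∑ j : Fin l.length, f (l.get j) = (l.map f).sum := by
  rw [← List.sum_ofFn]
  congr 1
  exact List.ext_get (by simp) (by simp)

theorem norm_sq_sub_compressedMatrix {d N : ℕ} (x : Fin N → EuclideanSpace ℝ (Fin d))
    (k : EuclideanSpace ℝ (Fin d) → EuclideanSpace ℝ (Fin d) → ℝ)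
    (b : List (Finset (Fin N) × (Fin N → ℝ))) (η : ℝ) :
    ‖sampletMatrix x k b - compressedMatrix x k b η‖ ^ 2 =
      (b.map fun p => (b.map fun p' => compressionError x k η p p').sum).sum := by
  have h0 : 0 ≤ ∑ i, ∑ j, ‖(sampletMatrix x k b - compressedMatrix x k b η) i j‖ ^ (2 : ℝ) := by
    positivity
  rw [Matrix.frobenius_norm_def, ← Real.sqrt_eq_rpow, Real.sq_sqrt h0, ← sum_fin_get_eq_sum_map]
  refine Finset.sum_congr rfl fun j _ => ?_
  rw [← sum_fin_get_eq_sum_map]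
  refine Finset.sum_congr rfl fun j' _ => ?_
  rw [Real.rpow_two, Real.norm_eq_abs, sq_abs, compressionError, Matrix.sub_apply,
    compressedMatrix, Matrix.of_apply]
  split_ifs
  · rw [sub_zero, sampletMatrix, Matrix.of_apply]
  · simp

/-- The root box shares a point with the other box, so their distance is zero, whereas its diameter
is positive. This protects the scaling functions, whose moments need not vanish. -/
theorem not_admissible_univ {d N : ℕ} {x : Fin N → EuclideanSpace ℝ (Fin d)}
    (hx : Function.Injective x) (hN : 2 ≤ N) {η : ℝ} (hη : 0 < η) {v : Finset (Fin N)}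
    (hv : v.Nonempty) :
    ¬ Admissible x η Finset.univ v ∧ ¬ Admissible x η v Finset.univ := by
  obtain ⟨i, hi⟩ := hv
  have hpos : 0 < Metric.diam (boundingBox x Finset.univ) :=
    (maxEdge_pos hx (v := Finset.univ) (by simpa using hN)).trans_le
      (maxEdge_le_diam ⟨i, Finset.mem_univ i⟩)
  have h1 := mem_boundingBox (x := x) (Finset.mem_univ i)
  have h2 := mem_boundingBox (x := x) hi
  constructor
  · intro h
    have := h.trans ((setDist_le h1 h2).trans (dist_self _).le)
    exact absurd this (not_le.2 (mul_pos hη (lt_max_of_lt_left hpos)))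
  · intro h
    have := h.trans ((setDist_le h2 h1).trans (dist_self _).le)
    exact absurd this (not_le.2 (mul_pos hη (lt_max_of_lt_right hpos)))

/-- Cauchy–Schwarz for a unit vector supported in the cluster. -/
theorem IsSamplet.sum_abs_sq_le {d N q : ℕ} {x : Fin N → EuclideanSpace ℝ (Fin d)}
    {p : Finset (Fin N) × (Fin N → ℝ)} (h : IsSamplet x q p) :
    (∑ i ∈ p.1, |p.2 i|) ^ 2 ≤ p.1.card := by
  refine sq_sum_le_card_mul_sum_sq.trans (mul_le_of_le_one_right (Nat.cast_nonneg _) ?_)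
  rw [← h.norm_sq, dotProduct]
  simp_rw [sq_abs, sq]
  exact Finset.sum_le_sum_of_subset_of_nonneg (Finset.subset_univ _)
    fun i _ _ => mul_self_nonneg _

/-- The ratio of the smaller to the larger of two lengths, raised to a power, is at most six times
the weight that `IsBisectionTree.innerSum_scale_le` sums over the tree. -/
theorem ratio_pow_le {L L' : ℝ} (hL : 0 < L) (hL' : 0 < L') {n : ℕ} (hn : n ≠ 0) :
    (L * L' / max L L' ^ 2) ^ n ≤ 6 * (L' * L / ((L + L') * (2 * L + L'))) := by
  have h1 : L ≤ max L L' := le_max_left _ _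
  have h2 : L' ≤ max L L' := le_max_right _ _
  set m := max L L'
  have hm : 0 < m := hL.trans_le h1
  refine (pow_le_of_le_one (by positivity) ?_ hn).trans ?_
  · rw [div_le_one (by positivity), sq]
    gcongr
  · rw [← mul_div_assoc, div_le_div_iff₀ (by positivity) (by positivity)]
    -- The 6 is 2 · 3, from L + L' ≤ 2m and 2L + L' ≤ 3m.
    have : (L + L') * (2 * L + L') ≤ (m + m) * (2 * m + m) := by gcongr
    nlinarith [mul_le_mul_of_nonneg_left this (mul_pos hL hL').le]

/-- With δ = η max(L, L'), which admissibility permits because a longest edge is at most the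
diameter, η separates from a scale-invariant ratio of lengths. -/
theorem compressionError_le {d q N : ℕ} {x : Fin N → EuclideanSpace ℝ (Fin d)}
    {k : EuclideanSpace ℝ (Fin d) → EuclideanSpace ℝ (Fin d) → ℝ} {A η : ℝ}
    (hη : 0 < η) {p p' : Finset (Fin N) × (Fin N → ℝ)} (hp : IsSamplet x q p)
    (hp' : IsSamplet x q p') (hx : Function.Injective x)
    (hA : ∀ δ : ℝ, 0 < δ → δ ≤ setDist (boundingBox x p.1) (boundingBox x p'.1) →
      |kernelPairing x k p.2 p'.2| ≤ A * ((∑ i ∈ p.1, |p.2 i|) * ∑ i ∈ p'.1, |p'.2 i|) *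
        (maxEdge x p.1 * maxEdge x p'.1 / δ ^ 2) ^ (q + 1)) :
    compressionError x k η p p' ≤
      6 * A ^ 2 * ((η ^ (2 * (q + 1)))⁻¹) ^ 2 * (p.1.card * (p'.1.card *
        (maxEdge x p'.1 * maxEdge x p.1 /
          ((maxEdge x p.1 + maxEdge x p'.1) * (2 * maxEdge x p.1 + maxEdge x p'.1))))) := by
  have hL := maxEdge_pos hx hp.two_le_card
  have hL' := maxEdge_pos hx hp'.two_le_card
  have hv : p.1.Nonempty := Finset.card_pos.1 (by have := hp.two_le_card; omega)
  have hv' : p'.1.Nonempty := Finset.card_pos.1 (by have := hp'.two_le_card; omega)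
  rw [compressionError]
  split_ifs with hadm
  · have hd : max (maxEdge x p.1) (maxEdge x p'.1) ≤
        max (Metric.diam (boundingBox x p.1)) (Metric.diam (boundingBox x p'.1)) :=
      max_le_max (maxEdge_le_diam hv) (maxEdge_le_diam hv')
    have hs := hp.sum_abs_sq_le
    have hs' := hp'.sum_abs_sq_le
    have hE := hA (η * max (maxEdge x p.1) (maxEdge x p'.1))
      (mul_pos hη (lt_max_of_lt_left hL)) ((mul_le_mul_of_nonneg_left hd hη.le).trans hadm)
    have hr := ratio_pow_le hL hL' (n := 2 * (q + 1)) (by omega)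
    have hm : 0 < max (maxEdge x p.1) (maxEdge x p'.1) := lt_max_of_lt_left hL
    set L := maxEdge x p.1
    set L' := maxEdge x p'.1
    set m := max L L'
    set a := ∑ i ∈ p.1, |p.2 i|
    set a' := ∑ i ∈ p'.1, |p'.2 i|
    calc kernelPairing x k p.2 p'.2 ^ 2 = |kernelPairing x k p.2 p'.2| ^ 2 := (sq_abs _).symm
      _ ≤ (A * (a * a') * (L * L' / (η * m) ^ 2) ^ (q + 1)) ^ 2 :=
        pow_le_pow_left₀ (abs_nonneg _) hE 2
      _ = A ^ 2 * ((η ^ (2 * (q + 1)))⁻¹) ^ 2 * (a ^ 2 * (a' ^ 2 *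
            (L * L' / m ^ 2) ^ (2 * (q + 1)))) := by
        have : L * L' / (η * m) ^ 2 = (η ^ 2)⁻¹ * (L * L' / m ^ 2) := by field_simp
        rw [this, mul_pow _ _ (q + 1), inv_pow, ← pow_mul, mul_comm 2 (q + 1), pow_mul _ (q + 1) 2]
        ring
      _ ≤ A ^ 2 * ((η ^ (2 * (q + 1)))⁻¹) ^ 2 * (p.1.card * (p'.1.card *
            (6 * (L' * L / ((L + L') * (2 * L + L')))))) := by gcongr
      _ = _ := by ring
  · positivity

theorem sum_map_append_eq_of_eq_zero {α : Type*} (l₁ l₂ : List α) (f : α → ℝ)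
    (h : ∀ a ∈ l₁, f a = 0) : ((l₁ ++ l₂).map f).sum = (l₂.map f).sum := by
  rw [List.map_append, List.sum_append, List.sum_eq_zero, zero_add]
  intro y hy
  obtain ⟨a, ha, rfl⟩ := List.mem_map.1 hy
  exact h a ha

/-- Bound of the absolute compression error, given the decay of the entries. -/
theorem norm_sq_sub_compressedMatrix_le {d q N : ℕ} {x : Fin N → EuclideanSpace ℝ (Fin d)}
    {k : EuclideanSpace ℝ (Fin d) → EuclideanSpace ℝ (Fin d) → ℝ} {A η : ℝ}
    (hη : 0 < η) (hN : 2 ≤ N) (hx : Function.Injective x)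
    (hA : ∀ p p' : Finset (Fin N) × (Fin N → ℝ), IsSamplet x q p → IsSamplet x q p' →
      ∀ δ : ℝ, 0 < δ → δ ≤ setDist (boundingBox x p.1) (boundingBox x p'.1) →
      |kernelPairing x k p.2 p'.2| ≤ A * ((∑ i ∈ p.1, |p.2 i|) * ∑ i ∈ p'.1, |p'.2 i|) *
        (maxEdge x p.1 * maxEdge x p'.1 / δ ^ 2) ^ (q + 1))
    {t : ClusterTree N} (ht : t.cluster = Finset.univ)
    (hbt : IsBisectionTree x (numMonomials d q) t) {b : List (Finset (Fin N) × (Fin N → ℝ))}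
    (hb : IsSampletBasis x q t b) :
    ‖sampletMatrix x k b - compressedMatrix x k b η‖ ^ 2 ≤
      96 * A ^ 2 * numMonomials d q ^ 2 * d / Real.log 2 * ((η ^ (2 * (q + 1)))⁻¹) ^ 2 *
        (N ^ 2 * Real.log N) := by
  obtain ⟨Φ, S, hS, rfl⟩ := hb
  obtain ⟨-, -, hsam, hsum⟩ := hS.invariants hbt
  have hne : ∀ p ∈ Φ.map (fun φ => (t.cluster, φ)) ++ S, p.1.Nonempty := by
    intro p hp
    rcases List.mem_append.1 hp with hp | hp
    · obtain ⟨φ, -, rfl⟩ := List.mem_map.1 hp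
      exact hbt.nonempty
    · exact Finset.card_pos.1 (by have := (hsam p hp).two_le_card; omega)
  have hzero : ∀ p ∈ Φ.map (fun φ => (t.cluster, φ)),
      ∀ p' ∈ Φ.map (fun φ => (t.cluster, φ)) ++ S,
      compressionError x k η p p' = 0 ∧ compressionError x k η p' p = 0 := by
    intro p hp p' hp'
    obtain ⟨φ, -, rfl⟩ := List.mem_map.1 hp
    have := not_admissible_univ hx hN hη (hne p' hp')
    rw [← ht] at this
    exact ⟨if_neg this.1, if_neg this.2⟩
  rw [norm_sq_sub_compressedMatrix, sum_map_append_eq_of_eq_zero]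
  · have hstep : ∀ p ∈ S, ((Φ.map (fun φ => (t.cluster, φ)) ++ S).map fun p' =>
        compressionError x k η p p').sum ≤
        24 * A ^ 2 * ((η ^ (2 * (q + 1)))⁻¹) ^ 2 * numMonomials d q * N * d * p.1.card := by
      intro p hp
      rw [sum_map_append_eq_of_eq_zero _ _ _
        fun p' hp' => (hzero p' hp' p (List.mem_append_right _ hp)).2]
      have hD := maxEdge_pos hx (hsam p hp).two_le_card
      -- The scale D is the longest edge of the fixed cluster `p.1`. At the root the potential is at
      -- most d, one for each coordinate.
      have hscale : t.innerSum (fun v => v.card * (maxEdge x v * maxEdge x p.1 /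
          ((maxEdge x p.1 + maxEdge x v) * (2 * maxEdge x p.1 + maxEdge x v)))) ≤ 4 * N * d := by
        refine (hbt.innerSum_scale_le hD).trans ?_
        rw [ht, Finset.card_univ, Fintype.card_fin]
        refine mul_le_mul_of_nonneg_left ?_ (by positivity)
        refine (Finset.sum_le_card_nsmul _ _ 1 fun l _ => ?_).trans (by simp)
        have := edgeLength_nonneg (x := x) (ht ▸ hbt.nonempty) l
        exact div_le_one_of_le₀ (by linarith) (by positivity)
      have hg := hsum (fun v => v.card * (maxEdge x v * maxEdge x p.1 /
          ((maxEdge x p.1 + maxEdge x v) * (2 * maxEdge x p.1 + maxEdge x v))))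
          fun v => by
            have := maxEdge_nonneg (x := x) (v := v)
            positivity
      calc _ ≤ (S.map fun p' => 6 * A ^ 2 * ((η ^ (2 * (q + 1)))⁻¹) ^ 2 * p.1.card *
            (p'.1.card * (maxEdge x p'.1 * maxEdge x p.1 /
            ((maxEdge x p.1 + maxEdge x p'.1) * (2 * maxEdge x p.1 + maxEdge x p'.1))))).sum := by
            refine List.sum_le_sum fun p' hp' => ?_
            refine (compressionError_le hη (hsam p hp) (hsam p' hp') hx
              (hA p p' (hsam p hp) (hsam p' hp'))).trans_eq (by ring)
        _ ≤ 6 * A ^ 2 * ((η ^ (2 * (q + 1)))⁻¹) ^ 2 * p.1.card *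
            (numMonomials d q * (4 * N * d)) := by
            rw [List.sum_map_mul_left]
            gcongr
            exact hg.trans (by gcongr)
        _ = _ := by ring
    have hcard : t.innerSum (fun v => (v.card : ℝ)) ≤ 4 / Real.log 2 * (N * Real.log N) := by
      have := hbt.innerSum_card_le
      rwa [ht, Finset.card_univ, Fintype.card_fin] at this
    refine (List.sum_le_sum hstep).trans ?_
    rw [List.sum_map_mul_left]
    -- The factor 24 is 6 from the ratio bound times 4 from the sum over scales; the entropy bound
    -- contributes another 4, giving 96.
    calc _ ≤ 24 * A ^ 2 * ((η ^ (2 * (q + 1)))⁻¹) ^ 2 * numMonomials d q * N * d *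
          (numMonomials d q * (4 / Real.log 2 * (N * Real.log N))) := by
          gcongr
          exact (hsum (fun v => (v.card : ℝ)) fun v => Nat.cast_nonneg _).trans (by gcongr)
      _ = _ := by ring
  · intro p hp
    refine List.sum_eq_zero fun y hy => ?_
    obtain ⟨p', hp', rfl⟩ := List.mem_map.1 hy
    exact (hzero p hp p' hp').1

end Samplet

/-! ### The relative error -/

theorem corollary4p3p6 {d : ℕ} (hd : 0 < d)
    (Ω : Set (EuclideanSpace ℝ (Fin d))) (hΩ_open : IsOpen Ω) (hΩ_convex : Convex ℝ Ω)
    (q : ℕ) (k : EuclideanSpace ℝ (Fin d) → EuclideanSpace ℝ (Fin d) → ℝ)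
    (hk : Samplet.IsAsymptoticallySmooth Ω (q + 1) k)
    (C₁ C₂ : ℝ) (hC₁ : 0 < C₁) (hC₂ : 0 < C₂) :
    ∃ C : ℝ, 0 < C ∧
      ∀ (N : ℕ) (x : Fin N → EuclideanSpace ℝ (Fin d)), 2 ≤ N → (∀ i, x i ∈ Ω) →
        C₁ * (N : ℝ) ^ (-(1 / (d : ℝ))) ≤ Samplet.separationRadius x →
        ∀ t : Samplet.ClusterTree N, t.cluster = Finset.univ →
          Samplet.IsBisectionTree x (Samplet.numMonomials d q) t →
          ∀ b : List (Finset (Fin N) × (Fin N → ℝ)), Samplet.IsSampletBasis x q t b →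
            C₂ * (N : ℝ) ≤ ‖Samplet.sampletMatrix x k b‖ →
            ∀ η : ℝ, 0 < η →
              ‖Samplet.sampletMatrix x k b - Samplet.compressedMatrix x k b η‖ /
                  ‖Samplet.sampletMatrix x k b‖ ≤
                C * η ^ (-(2 * ((q : ℤ) + 1))) * √(Real.log (N : ℝ)) := by
  obtain ⟨D, hD, c, r, hc, hr, hDb⟩ := hk
  set A : ℝ := c * (q + 1 + (q + 1)).factorial *
    (d ^ (q + 1 + (q + 1)) / r ^ (q + 1 + (q + 1))) with hA
  have hl : 0 < Real.log 2 := Real.log_pos one_lt_two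
  set W : ℝ := 96 * A ^ 2 * Samplet.numMonomials d q ^ 2 * d / Real.log 2 with hW
  have hW0 : 0 < W := by
    have hm : 0 < Samplet.numMonomials d q := Nat.choose_pos (Nat.le_add_left d q)
    positivity
  -- W collects only d, q and the constants of the kernel; √W bounds the absolute error and C₂ comes
  -- from the lower bound on the norm.
  refine ⟨√W / C₂, by positivity, fun N x hN hx hsep t ht hbt b hb hnorm η hη => ?_⟩
  have hN0 : (0 : ℝ) < N := by positivity
  -- Distinct points give every cluster with two or more points a positive longest edge, hence δ > 0
  -- on admissible pairs.
  have hinj := Samplet.injective_of_separationRadius_pos (lt_of_lt_of_le (by positivity) hsep)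
  have herr := Samplet.norm_sq_sub_compressedMatrix_le (k := k) (A := A) hη hN hinj
    (fun p p' hp hp' δ hδ hδv => by
      have hv : p.1.Nonempty := Finset.card_pos.1 (by have := hp.two_le_card; omega)
      have hv' : p'.1.Nonempty := Finset.card_pos.1 (by have := hp'.two_le_card; omega)
      exact Samplet.abs_kernelPairing_le hΩ_open hΩ_convex hD hc hr hDb hx hv hv'
        (fun l => Samplet.edgeLength_le_maxEdge l) (fun l => Samplet.edgeLength_le_maxEdge l)
        Samplet.maxEdge_nonneg Samplet.maxEdge_nonneg hδ hδv hp.support hp'.support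
        (Samplet.annihilatesPolynomials_of_moment hp.support hp.moment_eq_zero)
        (Samplet.annihilatesPolynomials_of_moment hp'.support hp'.moment_eq_zero)) ht hbt hb
  have hlog : 0 ≤ Real.log N := Real.log_natCast_nonneg N
  have hη' : η ^ (-(2 * ((q : ℤ) + 1))) = (η ^ (2 * (q + 1)))⁻¹ := by
    rw [zpow_neg]
    norm_cast
  have hfin : ‖Samplet.sampletMatrix x k b - Samplet.compressedMatrix x k b η‖ ≤
      √W * (η ^ (2 * (q + 1)))⁻¹ * (N * √(Real.log N)) := by
    refine abs_le_of_sq_le_sq' (herr.trans_eq ?_) (by positivity) |>.2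
    rw [← hW, mul_pow (√W * _), mul_pow √W, mul_pow (N : ℝ), Real.sq_sqrt hW0.le, Real.sq_sqrt hlog]
  rw [hη', div_le_iff₀ (lt_of_lt_of_le (by positivity) hnorm)]
  calc _ ≤ √W * (η ^ (2 * (q + 1)))⁻¹ * (N * √(Real.log N)) := hfin
    _ = √W / C₂ * (η ^ (2 * (q + 1)))⁻¹ * √(Real.log N) * (C₂ * N) := by field_simp
    _ ≤ _ := by gcongr
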